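/- Let $\Lambda=\mathbb{Z}\lambda_1+\mathbb{Z}\lambda_2\subset\mathbb{C}$ be a lattice ($\lambda_1,\lambda_2$ linearly independent over $\mathbb{R}$), let $\mathcal{K}_\Lambda$ be the field of $\Lambda$-elliptic functions (meromorphic functions on $\mathbb{C}$ with every $\lambda\in\Lambda$ as a period), fix $s\in\mathbb{C}\setminus\mathbb{Q}\Lambda$, and let $\tau(f)(z)=f(z+s)$ for $f\in\mathcal{K}_\Lambda$. Call $f\in\mathcal{K}_\Lambda$ summable if $f=\tau(g)-g$ for some $g\in\mathcal{K}_\Lambda$. For $\alpha\in\mathbb{C}$ and $j\ge 1$ let $c_j(f,\alpha)$ be the coefficient of $(z-\alpha)^{-j}$ in the Laurent expansion of $f$ at $\alpha$. For $\omega\in\mathbb{C}/(\Lambda\oplus\mathbb{Z}s)$ and $j\ge 1$, the analytic orbital residue is $$\mathrm{ores}(f,\omega,j)=\sum_{n\in\mathbb{Z}}c_j(f,q+ns),$$ where $q\in\omega$ is any representative (the sum does not depend on it). An analytic pinning $\mathcal{R}$ is a choice of a representative $q_\omega\in\omega$ for every $\omega\in\mathbb{C}/(\Lambda\oplus\mathbb{Z}s)$,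 where the representative of the class of $0$ is $0$. Let $$\zeta(z)=\frac1z+\sum_{0\ne\lambda\in\Lambda}\Big(\frac1{z-\lambda}+\frac1\lambda+\frac z{\lambda^2}\Big)$$ be the Weierstrass zeta function. Let $f\in\mathcal{K}_\Lambda$ and let $\mathcal{R}=\{q_\omega\}$ be an analytic pinning. Then only finitely many of the coefficients $c_j(f,q_\omega+ns)$ ($\omega\in\mathbb{C}/(\Lambda\oplus\mathbb{Z}s)$, $n\in\mathbb{Z}$, $j\ge1$) are nonzero, and there is a unique constant $C_{\mathcal{R}}(f)\in\mathbb{C}$ such that, as meromorphic functions, $$f(z)=C_{\mathcal{R}}(f)+\sum_{\omega}\sum_{n\in\mathbb{Z}}\sum_{j\ge1}\frac{(-1)^{j-1}c_j(f,q_\omega+ns)}{(j-1)!}\,\zeta^{(j-1)}(z-q_\omega-ns).$$ Define the analytic panorbital residues of $f$ relative to $\mathcal{R}$ by $$\mathrm{pano}_{\mathcal{R}}(f,0)=C_{\mathcal{R}}(f),\qquad \mathrm{pano}_{\mathcal{R}}(f,1)=\sum_{\omega}\sum_{n\in\mathbb{Z}}n\,c_1(f,q_\omega+ns).$$ Then $f$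 is summable if and only if $\mathrm{ores}(f,\omega,j)=0$ for all $\omega\in\mathbb{C}/(\Lambda\oplus\mathbb{Z}s)$ and all $j\ge1$, and $\mathrm{pano}_{\mathcal{R}}(f,0)=\mathrm{pano}_{\mathcal{R}}(f,1)=0$. -/

import Mathlib

open scoped Topology Polynomial

namespace EllipticSummability

/-- A function `f : ℂ → ℂ` representing an element of the field of elliptic functions of the
lattice spanned by `L`: it is meromorphic on `ℂ` and has every lattice vector as a period.
The value of `f` at a pole is irrelevant; two such functions represent the same element of the
field exactly when they agree off a discrete closed set, that is, along `Filter.codiscrete ℂ`. -/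
structure IsElliptic (L : PeriodPair) (f : ℂ → ℂ) : Prop where
  meromorphic : Meromorphic f
  periodic : ∀ l ∈ L.lattice, Function.Periodic f l

/-- The shift automorphism `τ`, sending `f(z)` to `f(z + s)`. -/
def shift (s : ℂ) (f : ℂ → ℂ) : ℂ → ℂ := fun z => f (z + s)

/-- `f` is summable: `f = τ(g) - g` as meromorphic functions, for some elliptic `g`. -/
def IsSummable (L : PeriodPair) (s : ℂ) (f : ℂ → ℂ) : Prop :=
  ∃ g : ℂ → ℂ, IsElliptic L g ∧ f =ᶠ[Filter.codiscrete ℂ] fun z => shift s g z - g z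

/-- The Weierstrass zeta function
`ζ(z) = 1 / z + ∑_{l ∈ Λ, l ≠ 0} (1 / (z - l) + 1 / l + z / l ^ 2)`.
The term of the sum below at `l = 0` is `1 / z`, because `1 / 0 = 0` in Lean. -/
noncomputable def weierstrassZeta (L : PeriodPair) (z : ℂ) : ℂ :=
  ∑' l : L.lattice, (1 / (z - l) + 1 / (l : ℂ) + z / (l : ℂ) ^ 2)

/-- `P((z - α)⁻¹)` is the principal part of `f` at `α`: `P` has no constant term, and
`f(z) - P((z - α)⁻¹)` extends analytically across `α`. -/
def HasPrincipalPartAt (f : ℂ → ℂ) (α : ℂ) (P : ℂ[X]) : Prop :=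
  P.coeff 0 = 0 ∧ ∃ h : ℂ → ℂ, AnalyticAt ℂ h α ∧
    ∀ᶠ z in 𝓝[≠] α, f z = h z + P.eval (z - α)⁻¹

theorem exists_hasPrincipalPartAt {f : ℂ → ℂ} {α : ℂ} (hf : MeromorphicAt f α) :
    ∃ P, HasPrincipalPartAt f α P := by
  have key : ∀ (n : ℕ) (g : ℂ → ℂ), AnalyticAt ℂ g α →
      ∃ P, HasPrincipalPartAt (fun z => ((z - α)⁻¹) ^ n * g z) α P := by
    intro n
    induction n with
    | zero =>
      intro g hg
      exact ⟨0, by simp, g, hg, by simp⟩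
    | succ n ih =>
      intro g hg
      have hd : AnalyticAt ℂ (dslope g α) α := by
        obtain ⟨p, hp⟩ := hg
        exact ⟨_, hp.has_fpower_series_dslope_fslope⟩
      obtain ⟨P, hP0, h, hh, he⟩ := ih _ hd
      refine ⟨P + Polynomial.C (g α) * Polynomial.X ^ (n + 1), by simp [hP0], h, hh, ?_⟩
      filter_upwards [he, self_mem_nhdsWithin] with z hz hzα
      have hne : z - α ≠ 0 := sub_ne_zero.mpr hzα
      have h1 : g z = g α + (z - α) * dslope g α z := by
        have := sub_smul_dslope g α z
        rw [smul_eq_mul] at this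
        rw [this]; ring
      simp only [Polynomial.eval_add, Polynomial.eval_mul, Polynomial.eval_C,
        Polynomial.eval_pow, Polynomial.eval_X]
      rw [← add_assoc, ← hz, h1, pow_succ]
      field_simp
      ring
  obtain ⟨n, hn⟩ := hf
  obtain ⟨P, hP0, h, hh, he⟩ := key n _ hn
  refine ⟨P, hP0, h, hh, ?_⟩
  filter_upwards [he, self_mem_nhdsWithin] with z hz hzα
  have hne : z - α ≠ 0 := sub_ne_zero.mpr hzα
  rw [← hz, smul_eq_mul, ← mul_assoc, ← mul_pow, inv_mul_cancel₀ hne, one_pow, one_mul]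

theorem HasPrincipalPartAt.unique {f : ℂ → ℂ} {α : ℂ} {P Q : ℂ[X]}
    (hP : HasPrincipalPartAt f α P) (hQ : HasPrincipalPartAt f α Q) : P = Q := by
  obtain ⟨hP0, h, hh, hPe⟩ := hP
  obtain ⟨hQ0, k, hk, hQe⟩ := hQ
  have hinv : Filter.Tendsto (fun z : ℂ => ‖(z - α)⁻¹‖) (𝓝[≠] α) Filter.atTop := by
    have h1 : Filter.Tendsto (fun z : ℂ => z - α) (𝓝[≠] α) (𝓝[≠] 0) := by
      refine tendsto_nhdsWithin_iff.mpr ⟨?_, ?_⟩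
      · have : Filter.Tendsto (fun z : ℂ => z - α) (𝓝 α) (𝓝 (α - α)) :=
          (continuous_id.sub continuous_const).tendsto α
        rw [sub_self] at this
        exact this.mono_left nhdsWithin_le_nhds
      · filter_upwards [self_mem_nhdsWithin] with z hz
        exact sub_ne_zero.mpr hz
    exact (tendsto_norm_inv_nhdsNE_zero_atTop).comp h1
  have hdeg : (P - Q).degree ≤ 0 := by
    by_contra hlt
    have ht := (P - Q).tendsto_norm_atTop (not_le.mp hlt) hinv
    have hb : Filter.Tendsto (fun z => ‖k z - h z‖) (𝓝[≠] α) (𝓝 ‖k α - h α‖) :=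
      ((hk.continuousAt.sub hh.continuousAt).norm.tendsto).mono_left nhdsWithin_le_nhds
    refine not_tendsto_atTop_of_tendsto_nhds hb (ht.congr' ?_)
    filter_upwards [hPe, hQe] with z h1 h2
    rw [Polynomial.eval_sub]
    congr 1
    linear_combination h2 - h1
  have := Polynomial.eq_C_of_degree_le_zero hdeg
  rw [Polynomial.coeff_sub, hP0, hQ0, sub_self, Polynomial.C_0, sub_eq_zero] at this
  exact this

open Classical in
/-- The coefficient `c_j(f, α)` of `(z - α)^(-j)`, for `j ≥ 1`, in the Laurent expansion of a
meromorphic function `f` at `α` (which is `0` if `f` has no pole at `α`). -/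
noncomputable def polarCoeff (f : ℂ → ℂ) (j : ℕ) (α : ℂ) : ℂ :=
  if h : ∃ P, HasPrincipalPartAt f α P then h.choose.coeff j else 0

theorem HasPrincipalPartAt.polarCoeff_eq {f : ℂ → ℂ} {α : ℂ} {P : ℂ[X]}
    (hP : HasPrincipalPartAt f α P) (j : ℕ) : polarCoeff f j α = P.coeff j := by
  have h : ∃ P, HasPrincipalPartAt f α P := ⟨P, hP⟩
  rw [polarCoeff, dif_pos h, h.choose_spec.unique hP]

/-- The subgroup `Λ ⊕ ℤ s` of `ℂ`. -/
noncomputable def orbitLattice (L : PeriodPair) (s : ℂ) : Submodule ℤ ℂ :=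
  L.lattice ⊔ Submodule.span ℤ {s}

/-- The set `ℂ / (Λ ⊕ ℤ s)` of orbits. -/
abbrev Orbit (L : PeriodPair) (s : ℂ) : Type := ℂ ⧸ orbitLattice L s

/-- The analytic orbital residue `ores(f, ω, j) = ∑_{n ∈ ℤ} c_j(f, q_ω + n s)`, for a chosen
representative `q_ω` of `ω`. For elliptic `f` the choice does not matter, see
`orbitalResidue_mk`. -/
noncomputable def orbitalResidue {L : PeriodPair} {s : ℂ} (f : ℂ → ℂ) (ω : Orbit L s) (j : ℕ) :
    ℂ :=
  ∑ᶠ n : ℤ, polarCoeff f j (Quotient.out ω + n * s)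

theorem polarCoeff_add_period {f : ℂ → ℂ} {l : ℂ} (hl : Function.Periodic f l)
    (hf : Meromorphic f) (j : ℕ) (α : ℂ) : polarCoeff f j (α + l) = polarCoeff f j α := by
  obtain ⟨P, hP⟩ := exists_hasPrincipalPartAt (hf (α + l))
  rw [hP.polarCoeff_eq]
  obtain ⟨hP0, h, hh, he⟩ := hP
  refine (HasPrincipalPartAt.polarCoeff_eq ⟨hP0, fun z => h (z + l), ?_, ?_⟩ j).symm
  · exact AnalyticAt.fun_comp (f := fun z => z + l) hh (by fun_prop)
  · have ht : Filter.Tendsto (fun z : ℂ => z + l) (𝓝[≠] α) (𝓝[≠] (α + l)) := by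
      refine tendsto_nhdsWithin_iff.mpr ⟨?_, ?_⟩
      · exact ((continuous_id.add continuous_const).tendsto α).mono_left nhdsWithin_le_nhds
      · filter_upwards [self_mem_nhdsWithin] with z hz
        simpa using hz
    filter_upwards [ht.eventually he] with z hz
    rw [← hl z, hz, add_sub_add_right_eq_sub]

theorem orbitalResidue_mk {L : PeriodPair} {s : ℂ} {f : ℂ → ℂ} (hf : IsElliptic L f) (q : ℂ)
    (j : ℕ) :
    orbitalResidue f (Submodule.Quotient.mk q : Orbit L s) j
      = ∑ᶠ n : ℤ, polarCoeff f j (q + n * s) := by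
  have h1 : (Submodule.Quotient.mk (Quotient.out (Submodule.Quotient.mk q : Orbit L s))
      : Orbit L s) = Submodule.Quotient.mk q := Quotient.out_eq _
  rw [orbitalResidue]
  generalize Quotient.out (Submodule.Quotient.mk q : Orbit L s) = r at h1 ⊢
  rw [Submodule.Quotient.eq, orbitLattice, Submodule.mem_sup] at h1
  obtain ⟨l, hl, y, hy, hly⟩ := h1
  obtain ⟨m, rfl⟩ := Submodule.mem_span_singleton.mp hy
  refine finsum_eq_of_bijective (fun n => n + m) (Equiv.addRight m).bijective fun n => ?_
  rw [← polarCoeff_add_period (hf.periodic l hl) hf.meromorphic j (q + _)]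
  congr 1
  rw [zsmul_eq_mul] at hly
  push_cast
  linear_combination -hly

/-- An analytic pinning: a representative of every orbit `ω ∈ ℂ / (Λ ⊕ ℤ s)`, where `0` is the
representative of its own orbit. -/
structure AnalyticPinning (L : PeriodPair) (s : ℂ) where
  rep : Orbit L s → ℂ
  mk_rep : ∀ ω, Submodule.Quotient.mk (rep ω) = ω
  rep_zero : rep 0 = 0

namespace AnalyticPinning

variable {L : PeriodPair} {s : ℂ}

/-- `f` has the `ζ`-expansion with constant term `C` relative to the pinning:
`f(z) = C + ∑_ω ∑_{n ∈ ℤ} ∑_{j ≥ 1} c_j(f, q_ω + n s) (-1)^(j-1) / (j-1)! ζ^(j-1)(z - q_ω - n s)`,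
a sum with only finitely many nonzero coefficients (here `k = j - 1`), as an identity of
meromorphic functions. -/
def HasZetaExpansion (R : AnalyticPinning L s) (f : ℂ → ℂ) (C : ℂ) : Prop :=
  {x : Orbit L s × ℤ × ℕ | polarCoeff f (x.2.2 + 1) (R.rep x.1 + x.2.1 * s) ≠ 0}.Finite ∧
  f =ᶠ[Filter.codiscrete ℂ] fun z =>
    C + ∑ᶠ (ω : Orbit L s) (n : ℤ) (k : ℕ),
      polarCoeff f (k + 1) (R.rep ω + n * s) * (-1) ^ k / (k.factorial : ℂ)
        * iteratedDeriv k (weierstrassZeta L) (z - R.rep ω - n * s)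

open Classical in
/-- The analytic panorbital residue of order `0`: the constant term of the `ζ`-expansion of `f`
relative to the pinning. -/
noncomputable def pano₀ (R : AnalyticPinning L s) (f : ℂ → ℂ) : ℂ :=
  if h : ∃ C, R.HasZetaExpansion f C then h.choose else 0

/-- The analytic panorbital residue of order `1`. -/
noncomputable def pano₁ (R : AnalyticPinning L s) (f : ℂ → ℂ) : ℂ :=
  ∑ᶠ (ω : Orbit L s) (n : ℤ), (n : ℂ) * polarCoeff f 1 (R.rep ω + n * s)

end AnalyticPinning

end EllipticSummability

/-!
Elliptic functions are determined, up to a constant, by their principal parts, and `τ` moves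
principal parts along the orbits of translation by `s`. So `f = τ(g) - g` is, up to a constant, an
equation between the coefficients: with `b` those of `g` and `c` those of `f`,
`c(ω, n, k) = b(ω, n + 1, k) - b(ω, n, k)`.

As `s` is not in `ℚ Λ`, the points `q_ω + n s` represent every class of `ℂ / Λ` once
(`AnalyticPinning.isTransversal_point`). For any such system of representatives and any finitely
supported family `b`, let `zetaSum` be the combination of translates of `ζ` and its derivatives
with the principal parts prescribed by `b`. It is quasi-periodic, and elliptic as soon as the sum
of its residues vanishes. The main analytic input, `IsElliptic.exists_eq_const_add_zetaSum`, is that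
an elliptic `f` is a constant plus the `zetaSum` of its own coefficients, and that the sum of its
residues is zero. The difference `f - zetaSum` is entire with elliptic derivative, hence equal to
`a z + C` by Liouville's theorem. If the sum of the residues were nonzero, then `ζ(z) + c z` would
be elliptic for some `c`; `not_periodic_weierstrassZeta_add_mul` excludes this without contour
integration.

If `f = τ(g) - g`, the orbital residues of `f` telescope to zero, the first moment `pano₁` is minus
the sum of the residues of `g` by summation by parts, hence zero, and subtracting the expansions of
`τ(g)` and `g` gives one of `f` without constant term. Conversely, if the orbital residues vanish,
the partial sums `b(ω, n, k) = ∑_{m < n} c(ω, m, k)` are finitely supported; their `zetaSum` is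
elliptic because its residues add up to `-pano₁ = 0`, and it is a `g` with `τ(g) - g = f` because
`pano₀ = 0`.
-/

open scoped Topology Polynomial

namespace EllipticSummability

open Filter PeriodPair

/-! ### The Weierstrass zeta function -/

section Zeta

variable (L : PeriodPair)

/-- A summand of `ζ` at a lattice vector of norm at least `2 r` is `O(r² ‖l‖⁻³)` on `‖z‖ < r`. -/
lemma norm_zetaSummand_le {r : ℝ} {z l : ℂ} (hz : ‖z‖ < r) (h : 2 * r ≤ ‖l‖) :
    ‖1 / (z - l) + 1 / l + z / l ^ 2‖ ≤ 2 * r ^ 2 * ‖l‖ ^ (-3 : ℝ) := by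
  have hr : 0 < r := (norm_nonneg z).trans_lt hz
  have hl : 0 < ‖l‖ := by linarith
  have hl0 : l ≠ 0 := norm_pos_iff.mp hl
  have hzl : z - l ≠ 0 := by
    rw [sub_ne_zero]; rintro rfl; linarith
  have hlow : ‖l‖ / 2 ≤ ‖z - l‖ := by
    rw [norm_sub_rev]
    exact .trans (by linarith) (norm_sub_norm_le l z)
  calc
    _ = ‖z ^ 2 / ((z - l) * l ^ 2)‖ := by congr 1; field_simp; ring
    _ = ‖z‖ ^ 2 / (‖z - l‖ * ‖l‖ ^ 2) := by simp
    _ ≤ r ^ 2 / (‖l‖ / 2 * ‖l‖ ^ 2) := by gcongr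
    _ = 2 * r ^ 2 / ‖l‖ ^ 3 := by field
    _ = _ := by
      rw [div_eq_mul_inv, Real.rpow_neg hl.le]
      norm_cast

/-- The Weierstrass zeta function with the summand of `l₀` omitted. -/
noncomputable def zetaExcept (l₀ z : ℂ) : ℂ :=
  ∑' l : L.lattice, if l.1 = l₀ then 0 else (1 / (z - l) + 1 / (l : ℂ) + z / (l : ℂ) ^ 2)

lemma hasSumLocallyUniformly_zetaExcept (l₀ : ℂ) :
    HasSumLocallyUniformly
      (fun (l : L.lattice) (z : ℂ) ↦
        if l.1 = l₀ then 0 else (1 / (z - l) + 1 / (l : ℂ) + z / (l : ℂ) ^ 2))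
      (zetaExcept L l₀) := by
  refine L.hasSumLocallyUniformly_aux (u := (2 * · ^ 2 * ‖·‖ ^ (-3 : ℝ))) _
    (fun _ _ ↦ (ZLattice.summable_norm_rpow _ _ (by simp; norm_num)).mul_left _) fun r hr ↦
    Filter.eventually_atTop.mpr ⟨2 * r, ?_⟩
  rintro _ h z hz l rfl
  split_ifs
  · rw [norm_zero]; positivity
  · exact norm_zetaSummand_le hz h

lemma hasDerivAt_zetaSummand {z l : ℂ} (h : z ≠ l) :
    HasDerivAt (fun z ↦ 1 / (z - l) + 1 / l + z / l ^ 2) (-(1 / (z - l) ^ 2 - 1 / l ^ 2)) z := by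
  have hzl : z - l ≠ 0 := sub_ne_zero.mpr h
  have h1 : HasDerivAt (fun z ↦ (z - l)⁻¹) (-1 / (z - l) ^ 2) z :=
    ((hasDerivAt_id z).sub_const l).fun_inv hzl
  have := (h1.add_const (1 / l)).add ((hasDerivAt_id z).div_const (l ^ 2))
  simp only [one_div]
  convert! this using 1
  · ext; simp
  · ring

lemma differentiableOn_zetaExcept (l₀ : ℂ) :
    DifferentiableOn ℂ (zetaExcept L l₀) (L.lattice \ {l₀})ᶜ := by
  refine (hasSumLocallyUniformly_zetaExcept L l₀).hasSumLocallyUniformlyOn.differentiableOn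
    (.of_forall fun s ↦ .fun_sum fun i hi ↦ ?_) L.isOpen_compl_lattice_sdiff
  split_ifs with h
  · simp
  · intro z hz
    refine (hasDerivAt_zetaSummand ?_).differentiableAt.differentiableWithinAt
    rintro rfl
    exact hz ⟨i.2, h⟩

lemma deriv_zetaExcept {l₀ z : ℂ} (hz : z ∈ ((L.lattice : Set ℂ) \ {l₀})ᶜ) :
    deriv (zetaExcept L l₀) z = -weierstrassPExcept L l₀ z := by
  have hne : ∀ {w : ℂ}, w ∈ ((L.lattice : Set ℂ) \ {l₀})ᶜ → ∀ i : L.lattice, i.1 ≠ l₀ →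
      w ≠ i := by
    rintro w hw i hi rfl
    exact hw ⟨i.2, hi⟩
  have h1 := (hasSumLocallyUniformly_zetaExcept L l₀).tendstoLocallyUniformlyOn.deriv
    (U := ((L.lattice : Set ℂ) \ {l₀})ᶜ)
    (.of_forall fun s ↦ .fun_sum fun i hi ↦ by
      split_ifs with h
      · simp
      · exact fun w hw ↦
          (hasDerivAt_zetaSummand (hne hw i h)).differentiableAt.differentiableWithinAt)
    L.isOpen_compl_lattice_sdiff
  have h2 := (h1.tendsto_at hz)
  refine tendsto_nhds_unique h2 ((L.hasSum_weierstrassPExcept l₀ z).neg.congr fun s ↦ ?_)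
  simp only [Function.comp_apply]
  have : HasDerivAt (fun w ↦ ∑ i ∈ s, if i.1 = l₀ then 0 else
      (1 / (w - i) + 1 / (i : ℂ) + w / (i : ℂ) ^ 2))
      (∑ i ∈ s, -if i.1 = l₀ then 0 else (1 / (z - i) ^ 2 - 1 / (i : ℂ) ^ 2)) z := by
    refine HasDerivAt.fun_sum fun i _ ↦ ?_
    split_ifs with h
    · simpa using hasDerivAt_const z (0 : ℂ)
    · exact hasDerivAt_zetaSummand (hne hz i h)
  exact this.deriv.symm

lemma zetaExcept_add (l₀ : L.lattice) (z : ℂ) :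
    zetaExcept L l₀ z + (1 / (z - l₀) + 1 / (l₀ : ℂ) + z / (l₀ : ℂ) ^ 2) =
      weierstrassZeta L z := by
  trans zetaExcept L l₀ z + ∑' i : L.lattice,
    if i = l₀.1 then (1 / (z - l₀) + 1 / (l₀ : ℂ) + z / (l₀ : ℂ) ^ 2) else 0
  · simp
  rw [zetaExcept, ← Summable.tsum_add]
  · congr with l
    split_ifs with e <;> simp [e]
  · exact (hasSumLocallyUniformly_zetaExcept L l₀).hasSum.summable
  · exact summable_of_hasFiniteSupport ((Set.finite_singleton l₀).subset (by simp_all))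

lemma zetaExcept_of_notMem {l₀ : ℂ} (hl : l₀ ∉ L.lattice) :
    zetaExcept L l₀ = weierstrassZeta L := by
  ext z
  unfold zetaExcept weierstrassZeta
  refine tsum_congr fun l ↦ if_neg ?_
  rintro rfl
  exact hl l.2

lemma weierstrassZeta_neg (z : ℂ) : weierstrassZeta L (-z) = -weierstrassZeta L z := by
  simp only [weierstrassZeta]
  rw [← (Equiv.neg L.lattice).tsum_eq, ← tsum_neg]
  congr with l
  have h : (1 : ℂ) / (-z + l) = -(1 / (z - l)) := by rw [← one_div_neg_eq_neg_one_div]; ring_nf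
  simp only [Equiv.neg_apply, NegMemClass.coe_neg, sub_neg_eq_add, h]
  rw [one_div_neg_eq_neg_one_div]
  ring

lemma differentiableOn_weierstrassZeta : DifferentiableOn ℂ (weierstrassZeta L) L.latticeᶜ := by
  rw [← zetaExcept_of_notMem L L.ω₁_div_two_notMem_lattice]
  exact (differentiableOn_zetaExcept L _).mono
    (Set.compl_subset_compl.mpr Set.sdiff_subset)

lemma deriv_weierstrassZeta {z : ℂ} (hz : z ∉ L.lattice) :
    deriv (weierstrassZeta L) z = -weierstrassP L z := by
  rw [← zetaExcept_of_notMem L L.ω₁_div_two_notMem_lattice,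
    ← L.weierstrassPExcept_of_notMem _ L.ω₁_div_two_notMem_lattice]
  exact deriv_zetaExcept L fun h ↦ hz h.1

lemma analyticAt_weierstrassZeta {z : ℂ} (hz : z ∉ L.lattice) :
    AnalyticAt ℂ (weierstrassZeta L) z :=
  (differentiableOn_weierstrassZeta L).analyticAt (L.isClosed_lattice.isOpen_compl.mem_nhds hz)

/-- Near a lattice point `ζ` is `(w - z)⁻¹` plus an analytic function. As `0⁻¹ = 0`, the identity
includes the value of that function at the lattice point itself. -/
lemma analyticAt_weierstrassZeta_sub_inv {z : ℂ} (hz : z ∈ L.lattice) :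
    AnalyticAt ℂ (fun w ↦ weierstrassZeta L w - (w - z)⁻¹) z := by
  have h1 : AnalyticAt ℂ (zetaExcept L z) z :=
    (differentiableOn_zetaExcept L z).analyticAt (L.compl_lattice_sdiff_singleton_mem_nhds z)
  have h2 : (fun w ↦ weierstrassZeta L w - (w - z)⁻¹) =
      fun w ↦ zetaExcept L z w + (1 / z + w * (z ^ 2)⁻¹) := by
    ext w
    rw [← zetaExcept_add L ⟨z, hz⟩]
    simp only [one_div]
    ring
  rw [h2]
  fun_prop

lemma isConnected_compl_lattice : IsConnected ((L.lattice : Set ℂ)ᶜ) :=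
  Set.Countable.isConnected_compl_of_one_lt_rank (by simp)
    (countable_of_Lindelof_of_discrete (X := L.lattice))

/-- `ζ` is quasi-periodic. The identity holds also at the lattice points, because the junk value of
`ζ` there is the constant term of its Laurent expansion. -/
theorem weierstrassZeta_add_lattice {l : ℂ} (hl : l ∈ L.lattice) (z : ℂ) :
    weierstrassZeta L (z + l) = weierstrassZeta L z + weierstrassZeta L l := by
  suffices ∃ c, ∀ z, weierstrassZeta L (z + l) = weierstrassZeta L z + c by
    obtain ⟨c, hc⟩ := this
    have h0 : weierstrassZeta L 0 = 0 := by
      have h := weierstrassZeta_neg L 0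
      rwa [neg_zero, CharZero.eq_neg_self_iff] at h
    have hl0 := hc 0
    rw [zero_add, h0, zero_add] at hl0
    rw [hc z, hl0]
  have hmem : ∀ z, z + l ∈ L.lattice ↔ z ∈ L.lattice := fun z ↦
    ⟨fun h ↦ by simpa using sub_mem h hl, fun h ↦ add_mem h hl⟩
  set D : ℂ → ℂ := fun z ↦ weierstrassZeta L (z + l) - weierstrassZeta L z with hD
  have hdiff : ∀ z ∉ L.lattice, HasDerivAt D 0 z := by
    intro z hz
    have h1 : HasDerivAt (weierstrassZeta L) (-weierstrassP L (z + l)) (z + l) := by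
      rw [← deriv_weierstrassZeta L (by rwa [hmem])]
      exact (analyticAt_weierstrassZeta L (by rwa [hmem])).differentiableAt.hasDerivAt
    have h2 : HasDerivAt (weierstrassZeta L) (-weierstrassP L z) z := by
      rw [← deriv_weierstrassZeta L hz]
      exact (analyticAt_weierstrassZeta L hz).differentiableAt.hasDerivAt
    have := (h1.comp_add_const z l).sub h2
    rw [L.weierstrassP_add_coe z ⟨l, hl⟩, sub_self] at this
    exact this
  have hconst : ∃ c, ∀ z ∉ L.lattice, D z = c := by
    obtain ⟨c, hc⟩ := IsOpen.exists_is_const_of_deriv_eq_zero (𝕜 := ℂ)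
      L.isClosed_lattice.isOpen_compl (isConnected_compl_lattice L).isPreconnected
      (fun z hz ↦ (hdiff z hz).differentiableAt.differentiableWithinAt)
      (fun z hz ↦ (hdiff z hz).deriv)
    exact ⟨c, hc⟩
  obtain ⟨c, hc⟩ := hconst
  refine ⟨c, fun z ↦ ?_⟩
  rw [← sub_eq_iff_eq_add']
  by_cases hz : z ∈ L.lattice
  · have hcont : ContinuousAt D z := by
      have h1 := (analyticAt_weierstrassZeta_sub_inv L hz).continuousAt
      have h2 : ContinuousAt (fun w ↦ weierstrassZeta L (w + l) - (w + l - (z + l))⁻¹) z :=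
        ContinuousAt.comp (f := fun w ↦ w + l)
          (g := fun w ↦ weierstrassZeta L w - (w - (z + l))⁻¹)
          (analyticAt_weierstrassZeta_sub_inv L ((hmem z).mpr hz)).continuousAt (by fun_prop)
      refine (h2.sub h1).congr (.of_forall fun w ↦ ?_)
      simp [hD]
    have h1 : Tendsto D (𝓝[≠] z) (𝓝 (D z)) := hcont.tendsto.mono_left nhdsWithin_le_nhds
    refine tendsto_nhds_unique (h1.congr' ?_) tendsto_const_nhds
    filter_upwards [self_mem_nhdsWithin, mem_nhdsWithin_of_mem_nhds
      (L.compl_lattice_sdiff_singleton_mem_nhds z)] with w hw hw'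
    exact hc w fun h ↦ hw' ⟨h, hw⟩
  · exact hc z hz

end Zeta

/-! ### Principal parts -/

lemma eventuallyEq_codiscrete_iff {f g : ℂ → ℂ} :
    f =ᶠ[codiscrete ℂ] g ↔ ∀ α, f =ᶠ[𝓝[≠] α] g := by
  rw [EventuallyEq, Filter.Eventually, codiscrete, mem_codiscreteWithin_iff_forall_mem_nhdsNE]
  simp [EventuallyEq, Filter.Eventually]

lemma tendsto_add_const_nhdsNE (c α : ℂ) :
    Tendsto (fun z : ℂ ↦ z + c) (𝓝[≠] α) (𝓝[≠] (α + c)) := by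
  refine tendsto_nhdsWithin_iff.mpr ⟨?_, ?_⟩
  · exact ((continuous_id.add continuous_const).tendsto α).mono_left nhdsWithin_le_nhds
  · filter_upwards [self_mem_nhdsWithin] with z hz
    simpa using hz

namespace HasPrincipalPartAt

variable {f g : ℂ → ℂ} {α : ℂ} {P Q : ℂ[X]}

lemma congr (hf : HasPrincipalPartAt f α P) (h : f =ᶠ[𝓝[≠] α] g) : HasPrincipalPartAt g α P := by
  obtain ⟨h0, k, hk, he⟩ := hf
  refine ⟨h0, k, hk, ?_⟩
  filter_upwards [he, h] with z h1 h2
  rw [← h2, h1]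

lemma of_analyticAt (hf : AnalyticAt ℂ f α) : HasPrincipalPartAt f α 0 :=
  ⟨by simp, f, hf, by simp⟩

lemma add (hf : HasPrincipalPartAt f α P) (hg : HasPrincipalPartAt g α Q) :
    HasPrincipalPartAt (fun z ↦ f z + g z) α (P + Q) := by
  obtain ⟨hP, h, hh, he⟩ := hf
  obtain ⟨hQ, k, hk, ke⟩ := hg
  refine ⟨by simp [hP, hQ], fun z ↦ h z + k z, hh.add hk, ?_⟩
  filter_upwards [he, ke] with z h1 h2
  rw [h1, h2, Polynomial.eval_add]
  ring

lemma const_mul (c : ℂ) (hf : HasPrincipalPartAt f α P) :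
    HasPrincipalPartAt (fun z ↦ c * f z) α (c • P) := by
  obtain ⟨hP, h, hh, he⟩ := hf
  refine ⟨by simp [hP], fun z ↦ c * h z, analyticAt_const.mul hh, ?_⟩
  filter_upwards [he] with z h1
  rw [h1, Polynomial.eval_smul, smul_eq_mul]
  ring

lemma sub (hf : HasPrincipalPartAt f α P) (hg : HasPrincipalPartAt g α Q) :
    HasPrincipalPartAt (fun z ↦ f z - g z) α (P - Q) := by
  have h := hf.add (hg.const_mul (-1))
  rw [neg_one_smul, ← sub_eq_add_neg] at h
  exact h.congr (.of_forall fun z ↦ by ring)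

lemma sum {ι : Type*} {s : Finset ι} {f : ι → ℂ → ℂ} {P : ι → ℂ[X]}
    (hf : ∀ i ∈ s, HasPrincipalPartAt (f i) α (P i)) :
    HasPrincipalPartAt (fun z ↦ ∑ i ∈ s, f i z) α (∑ i ∈ s, P i) := by
  classical
  induction s using Finset.induction_on with
  | empty => simpa using of_analyticAt (α := α) (analyticAt_const (v := (0 : ℂ)))
  | insert i s hi ih =>
    simp only [Finset.sum_insert hi]
    exact (hf i (Finset.mem_insert_self i s)).add
      (ih fun j hj ↦ hf j (Finset.mem_insert_of_mem hj))

lemma comp_add_const {c : ℂ} (hf : HasPrincipalPartAt f (α + c) P) :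
    HasPrincipalPartAt (fun z ↦ f (z + c)) α P := by
  obtain ⟨hP, h, hh, he⟩ := hf
  refine ⟨hP, fun z ↦ h (z + c), AnalyticAt.fun_comp (f := fun z ↦ z + c) hh (by fun_prop), ?_⟩
  filter_upwards [(tendsto_add_const_nhdsNE c α).eventually he] with z hz
  rw [hz, add_sub_add_right_eq_sub]

lemma meromorphicAt (hf : HasPrincipalPartAt f α P) : MeromorphicAt f α := by
  obtain ⟨hP, h, hh, he⟩ := hf
  have h1 : MeromorphicAt (fun z ↦ P.eval (z - α)⁻¹) α := by
    simp only [Polynomial.eval_eq_sum_range]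
    fun_prop
  refine (hh.meromorphicAt.add h1).congr ?_
  filter_upwards [he] with z hz
  rw [hz, Pi.add_apply]

/-- In the variable `u = (z - α)⁻¹` the derivation `d/dz` is `-u² d/du`. -/
lemma deriv (hf : HasPrincipalPartAt f α P) :
    HasPrincipalPartAt (deriv f) α (-(Polynomial.X ^ 2 * Polynomial.derivative P)) := by
  obtain ⟨hP, h, hh, he⟩ := hf
  refine ⟨by simp, _root_.deriv h, hh.deriv, ?_⟩
  have he' : ∀ᶠ z in 𝓝[≠] α, f =ᶠ[𝓝 z] fun w ↦ h w + P.eval (w - α)⁻¹ := by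
    rw [eventually_nhdsWithin_iff] at he ⊢
    filter_upwards [he.eventually_nhds] with z hz hzα
    filter_upwards [hz, isOpen_compl_singleton.mem_nhds hzα] with w hw hwα using hw hwα
  have hh' : ∀ᶠ z in 𝓝[≠] α, AnalyticAt ℂ h z :=
    hh.eventually_analyticAt.filter_mono nhdsWithin_le_nhds
  filter_upwards [he', hh', self_mem_nhdsWithin] with z h1 h2 hz
  have hzα : z - α ≠ 0 := sub_ne_zero.mpr hz
  have h3 : HasDerivAt (fun w ↦ (w - α)⁻¹) (-1 / (z - α) ^ 2) z :=
    ((hasDerivAt_id z).sub_const α).fun_inv hzα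
  have h4 := h2.differentiableAt.hasDerivAt.add ((P.hasDerivAt (z - α)⁻¹).comp z h3)
  rw [h1.deriv_eq]
  refine h4.deriv.trans ?_
  simp only [Polynomial.eval_neg, Polynomial.eval_mul, Polynomial.eval_pow, Polynomial.eval_X]
  rw [inv_pow]
  ring

end HasPrincipalPartAt

/-- A function all of whose principal parts vanish is entire, up to its values on a discrete set. -/
lemma exists_differentiable_of_hasPrincipalPartAt_zero {F : ℂ → ℂ}
    (hF : ∀ α, HasPrincipalPartAt F α 0) :
    ∃ H : ℂ → ℂ, Differentiable ℂ H ∧ ∀ α, F =ᶠ[𝓝[≠] α] H := by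
  have key : ∀ α, ∃ h : ℂ → ℂ, AnalyticAt ℂ h α ∧ (∀ᶠ z in 𝓝[≠] α, F z = h z) := by
    intro α
    obtain ⟨-, h, hh, he⟩ := hF α
    exact ⟨h, hh, by simpa using he⟩
  have lim : ∀ {h : ℂ → ℂ} {z : ℂ}, ContinuousAt h z → F =ᶠ[𝓝[≠] z] h →
      limUnder (𝓝[≠] z) F = h z := by
    intro h z hh he
    exact ((hh.tendsto.mono_left nhdsWithin_le_nhds).congr' he.symm).limUnder_eq
  set H : ℂ → ℂ := fun z ↦ limUnder (𝓝[≠] z) F with hH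
  have hloc : ∀ α, ∀ h : ℂ → ℂ, AnalyticAt ℂ h α → F =ᶠ[𝓝[≠] α] h → H =ᶠ[𝓝 α] h := by
    intro α h hh he
    have he' := he
    rw [EventuallyEq, eventually_nhdsWithin_iff] at he
    filter_upwards [he.eventually_nhds, hh.eventually_analyticAt] with z hz hhz
    by_cases hzα : z = α
    · subst hzα
      exact lim hh.continuousAt he'
    · refine lim hhz.continuousAt ?_
      filter_upwards [mem_nhdsWithin_of_mem_nhds hz,
        mem_nhdsWithin_of_mem_nhds (isOpen_compl_singleton.mem_nhds hzα)] with w hw hwα using hw hwα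
  refine ⟨H, fun α ↦ ?_, fun α ↦ ?_⟩ <;> obtain ⟨h, hh, he⟩ := key α
  · exact (hh.congr (hloc α h hh he).symm).differentiableAt
  · exact EventuallyEq.trans he ((hloc α h hh he).symm.filter_mono nhdsWithin_le_nhds)

/-! ### Entire functions and the absence of a single simple pole -/

section Entire

variable (L : PeriodPair)

/-- Liouville's theorem on the torus. -/
lemma exists_eq_const_of_periodic {H : ℂ → ℂ} (hH : Differentiable ℂ H)
    (hper : ∀ l ∈ L.lattice, ∀ z, H (z + l) = H z) : ∃ c, ∀ z, H z = c :=
  ⟨H 0, fun z ↦ hH.apply_eq_apply_of_bounded (IsZLattice.isCompact_range_of_periodic L.lattice _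
    hH.continuous fun z w hw ↦ hper w hw z).isBounded z 0⟩

/-- Two continuous functions that agree off a discrete set are equal. -/
lemma eq_of_eventuallyEq_nhdsNE {f g : ℂ → ℂ} (hf : Continuous f) (hg : Continuous g)
    (h : ∀ α, f =ᶠ[𝓝[≠] α] g) : f = g := by
  ext α
  exact tendsto_nhds_unique ((hf.tendsto α).mono_left nhdsWithin_le_nhds)
    (((hg.tendsto α).mono_left nhdsWithin_le_nhds).congr' (h α).symm)

/-- No elliptic function has a single simple pole modulo `Λ`: `ζ(z) + c z` is never periodic.
For otherwise the odd function `φ(z) = ζ(z) + c z` would vanish at the half periods, so that in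
`φ(z) φ(z + ω₁ / 2)` every pole would be cancelled by a zero; this product would be constant,
and `0` because it vanishes at `ω₂ / 2`. -/
theorem not_periodic_weierstrassZeta_add_mul (c : ℂ)
    (h : ∀ l ∈ L.lattice, ∀ z, weierstrassZeta L (z + l) + c * (z + l) =
      weierstrassZeta L z + c * z) : False := by
  set φ : ℂ → ℂ := fun z ↦ weierstrassZeta L z + c * z with hφ
  have hper : ∀ l ∈ L.lattice, ∀ z, φ (z + l) = φ z := h
  have hodd : ∀ z, φ (-z) = -φ z := fun z ↦ by
    simp only [hφ, weierstrassZeta_neg]; ring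
  have hhalf : ∀ l ∈ L.lattice, φ (l / 2) = 0 := by
    intro l hl
    have h1 := hper l hl (-(l / 2))
    rw [show -(l / 2) + l = l / 2 by ring, hodd, CharZero.eq_neg_self_iff] at h1
    exact h1
  have han : ∀ z ∉ L.lattice, AnalyticAt ℂ φ z := fun z hz ↦
    (analyticAt_weierstrassZeta L hz).fun_add (by fun_prop)
  have hpole : ∀ z ∈ L.lattice, ∃ a : ℂ → ℂ, AnalyticAt ℂ a z ∧ ∀ w, φ w = a w + (w - z)⁻¹ := by
    intro z hz
    refine ⟨fun w ↦ (weierstrassZeta L w - (w - z)⁻¹) + c * w,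
      (analyticAt_weierstrassZeta_sub_inv L hz).fun_add (by fun_prop), fun w ↦ ?_⟩
    simp only [hφ]; ring
  set e := L.ω₁ / 2 with he
  have heL : e ∉ L.lattice := L.ω₁_div_two_notMem_lattice
  have h2e : 2 * e ∈ L.lattice := by
    rw [he, mul_div_cancel₀ _ two_ne_zero]; exact L.ω₁_mem_lattice
  set ψ : ℂ → ℂ := fun z ↦ φ z * φ (z + e) with hψ
  have hψe : ∀ z, ψ (z + e) = ψ z := by
    intro z
    simp only [hψ]
    rw [add_assoc, ← two_mul, hper _ h2e, mul_comm]
  have hψper : ∀ l ∈ L.lattice, ∀ z, ψ (z + l) = ψ z := by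
    intro l hl z
    simp only [hψ]
    rw [add_right_comm, hper l hl, hper l hl]
  -- The pole of `φ` at a lattice point is cancelled by the zero of the second factor.
  have hψ0 : ∀ α ∈ L.lattice, HasPrincipalPartAt ψ α 0 := by
    intro α hα
    obtain ⟨a, ha, haφ⟩ := hpole α hα
    have hu : AnalyticAt ℂ (fun z ↦ φ (z + e)) α :=
      AnalyticAt.fun_comp (f := fun z ↦ z + e)
        (han _ fun hmem ↦ heL (by simpa using sub_mem hmem hα)) (by fun_prop)
    have hu0 : φ (α + e) = 0 := by
      rw [add_comm, hper α hα, he, hhalf _ L.ω₁_mem_lattice]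
    have hd : AnalyticAt ℂ (dslope (fun z ↦ φ (z + e)) α) α := by
      obtain ⟨p, hp⟩ := hu
      exact ⟨_, hp.has_fpower_series_dslope_fslope⟩
    refine (HasPrincipalPartAt.of_analyticAt ((ha.fun_mul hu).fun_add hd)).congr ?_
    filter_upwards [self_mem_nhdsWithin] with z hz
    have hne : z - α ≠ 0 := sub_ne_zero.mpr hz
    have h1 := sub_smul_dslope (fun z ↦ φ (z + e)) α z
    rw [smul_eq_mul, hu0, sub_zero] at h1
    simp only [hψ]
    rw [haφ z, ← h1]
    field_simp
  have hψ1 : ∀ α, HasPrincipalPartAt ψ α 0 := by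
    intro α
    by_cases h1 : α ∈ L.lattice
    · exact hψ0 α h1
    by_cases h2 : α + e ∈ L.lattice
    · exact (hψ0 _ h2).comp_add_const.congr (.of_forall hψe)
    · exact .of_analyticAt ((han α h1).fun_mul
        (AnalyticAt.fun_comp (f := fun z ↦ z + e) (han _ h2) (by fun_prop)))
  obtain ⟨H, hH, hHψ⟩ := exists_differentiable_of_hasPrincipalPartAt_zero hψ1
  obtain ⟨k, hk⟩ := exists_eq_const_of_periodic L hH (by
    intro l hl
    refine congr_fun (eq_of_eventuallyEq_nhdsNE (f := fun z ↦ H (z + l))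
      (hH.continuous.comp (by fun_prop)) hH.continuous fun α ↦ ?_)
    filter_upwards [hHψ α, (tendsto_add_const_nhdsNE l α).eventually (hHψ (α + l))] with z h1 h2
    rw [← h1, ← h2, hψper l hl])
  have hψk : ∀ α, ∀ᶠ z in 𝓝[≠] α, ψ z = k := fun α ↦ by
    filter_upwards [hHψ α] with z hz
    rw [hz, hk]
  -- The value of the constant, at `ω₂ / 2`.
  have hk0 : k = 0 := by
    have hw : L.ω₂ / 2 ∉ L.lattice := L.ω₂_div_two_notMem_lattice
    have hwe : L.ω₂ / 2 + e ∉ L.lattice := by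
      have := (L.mul_ω₁_add_mul_ω₂_mem_lattice (α := 1 / 2) (β := 1 / 2)).not.mpr (by norm_num)
      convert! this using 1
      simp only [he]; push_cast; ring_nf
    have hcont : ContinuousAt ψ (L.ω₂ / 2) := ((han _ hw).fun_mul
      (AnalyticAt.fun_comp (f := fun z ↦ z + e) (han _ hwe) (by fun_prop))).continuousAt
    have h1 : Tendsto ψ (𝓝[≠] (L.ω₂ / 2)) (𝓝 (ψ (L.ω₂ / 2))) :=
      hcont.tendsto.mono_left nhdsWithin_le_nhds
    have h2 : ψ (L.ω₂ / 2) = 0 := by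
      simp only [hψ]
      rw [hhalf _ L.ω₂_mem_lattice, zero_mul]
    rw [h2] at h1
    exact tendsto_nhds_unique (tendsto_const_nhds.congr' ((hψk _).mono fun z hz ↦ hz.symm)) h1
  obtain ⟨a, ha, haφ⟩ := hpole 0 L.lattice.zero_mem
  have hatop : Tendsto (fun z ↦ ‖φ z‖) (𝓝[≠] 0) atTop := by
    have h1 : Tendsto (fun z : ℂ ↦ ‖z⁻¹‖) (𝓝[≠] 0) atTop := tendsto_norm_inv_nhdsNE_zero_atTop
    have h2 : Tendsto (fun z ↦ -‖a z‖) (𝓝[≠] 0) (𝓝 (-‖a 0‖)) :=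
      (ha.continuousAt.norm.neg.tendsto).mono_left nhdsWithin_le_nhds
    refine tendsto_atTop_mono (fun z ↦ ?_) (h2.add_atTop h1)
    rw [haφ z, sub_zero]
    have := norm_sub_norm_le z⁻¹ (-a z)
    rw [norm_neg, sub_neg_eq_add, add_comm z⁻¹] at this
    linarith
  have hne : ∀ᶠ z in 𝓝[≠] (0 : ℂ), φ z ≠ 0 := by
    filter_upwards [hatop.eventually_gt_atTop 0] with z hz
    exact norm_pos_iff.mp hz
  -- Hence `φ` vanishes near `ω₁ / 2`, and so identically, which the pole at `0` forbids.
  have hφe : ∃ᶠ z in 𝓝[≠] e, φ z = 0 := by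
    have h1 : ∀ᶠ z in 𝓝[≠] (0 : ℂ), φ (z + e) = 0 := by
      filter_upwards [hne, hψk 0] with z hz hz'
      rw [hk0] at hz'
      exact (mul_eq_zero.mp hz').resolve_left hz
    have h2 := tendsto_add_const_nhdsNE e 0
    rw [zero_add] at h2
    exact h2.frequently h1.frequently
  have hzero := AnalyticOnNhd.eqOn_zero_of_preconnected_of_frequently_eq_zero
    (fun z hz ↦ han z hz) (isConnected_compl_lattice L).isPreconnected
    (show e ∈ (L.lattice : Set ℂ)ᶜ from heL) hφe
  have hlat : ∀ᶠ z in 𝓝[≠] (0 : ℂ), z ∉ L.lattice := by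
    filter_upwards [self_mem_nhdsWithin, mem_nhdsWithin_of_mem_nhds
      (L.compl_lattice_sdiff_singleton_mem_nhds 0)] with w hw hw' hmem
    exact hw' ⟨hmem, hw⟩
  obtain ⟨z, hz, hz'⟩ := (hlat.and hne).exists
  exact hz' (hzero hz)

/-! ### Derivatives of the Weierstrass zeta function -/

lemma hasPrincipalPartAt_iteratedDeriv_weierstrassZeta {α : ℂ} (hα : α ∈ L.lattice) (k : ℕ) :
    HasPrincipalPartAt (iteratedDeriv k (weierstrassZeta L)) α
      (((-1) ^ k * (k.factorial : ℂ)) • Polynomial.X ^ (k + 1)) := by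
  induction k with
  | zero =>
    refine ⟨by simp, _, analyticAt_weierstrassZeta_sub_inv L hα, .of_forall fun z ↦ ?_⟩
    simp
  | succ k ih =>
    rw [iteratedDeriv_succ]
    convert! ih.deriv using 1
    rw [Polynomial.derivative_smul, Polynomial.derivative_X_pow]
    simp only [Polynomial.smul_eq_C_mul, Nat.factorial_succ]
    push_cast
    simp only [map_mul, map_pow, map_neg, map_one, map_add, map_natCast]
    ring

lemma analyticAt_iteratedDeriv_weierstrassZeta {α : ℂ} (hα : α ∉ L.lattice) (k : ℕ) :
    AnalyticAt ℂ (iteratedDeriv k (weierstrassZeta L)) α := by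
  induction k with
  | zero => simpa using analyticAt_weierstrassZeta L hα
  | succ k ih => rw [iteratedDeriv_succ]; exact ih.deriv

lemma iteratedDeriv_weierstrassZeta_add_lattice {l : ℂ} (hl : l ∈ L.lattice) (k : ℕ) (z : ℂ) :
    iteratedDeriv k (weierstrassZeta L) (z + l) =
      iteratedDeriv k (weierstrassZeta L) z + if k = 0 then weierstrassZeta L l else 0 := by
  have h1 : (fun z ↦ weierstrassZeta L (z + l)) =
      fun z ↦ weierstrassZeta L l + weierstrassZeta L z := by
    ext z; rw [weierstrassZeta_add_lattice L hl, add_comm]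
  have h2 := congr_fun (iteratedDeriv_comp_add_const k (weierstrassZeta L) l) z
  rw [← h2, h1]
  split_ifs with hk
  · subst hk; simp [add_comm]
  · rw [iteratedDeriv_const_add (Nat.pos_of_ne_zero hk), add_zero]

end Entire

/-! ### Laurent coefficients of elliptic functions -/

section Coefficients

variable {f g : ℂ → ℂ} {α : ℂ}

lemma polarCoeff_congr (h : f =ᶠ[𝓝[≠] α] g) (hg : MeromorphicAt g α) (j : ℕ) :
    polarCoeff f j α = polarCoeff g j α := by
  obtain ⟨P, hP⟩ := exists_hasPrincipalPartAt hg
  rw [hP.polarCoeff_eq, (hP.congr h.symm).polarCoeff_eq]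

lemma polarCoeff_sub (hf : MeromorphicAt f α) (hg : MeromorphicAt g α) (j : ℕ) :
    polarCoeff (fun z ↦ f z - g z) j α = polarCoeff f j α - polarCoeff g j α := by
  obtain ⟨P, hP⟩ := exists_hasPrincipalPartAt hf
  obtain ⟨Q, hQ⟩ := exists_hasPrincipalPartAt hg
  rw [hP.polarCoeff_eq, hQ.polarCoeff_eq, (hP.sub hQ).polarCoeff_eq, Polynomial.coeff_sub]

lemma polarCoeff_shift {s : ℂ} (hf : MeromorphicAt f (α + s)) (j : ℕ) :
    polarCoeff (shift s f) j α = polarCoeff f j (α + s) := by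
  obtain ⟨P, hP⟩ := exists_hasPrincipalPartAt hf
  rw [hP.polarCoeff_eq]
  exact hP.comp_add_const.polarCoeff_eq j

lemma meromorphic_shift (hf : Meromorphic f) (s : ℂ) : Meromorphic (shift s f) := fun α ↦ by
  obtain ⟨P, hP⟩ := exists_hasPrincipalPartAt (hf (α + s))
  exact hP.comp_add_const.meromorphicAt

end Coefficients

/-- The points `p i` form a complete system of representatives of `ℂ / Λ`. -/
structure IsTransversal (L : PeriodPair) {ι : Type*} (p : ι → ℂ) : Prop where
  eq_of_sub_mem : ∀ i j, p i - p j ∈ L.lattice → i = j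
  exists_sub_mem : ∀ α, ∃ i, α - p i ∈ L.lattice

variable {L : PeriodPair} {ι : Type*} {p : ι → ℂ} {f : ℂ → ℂ}

/-- Every class modulo `Λ` meets a fixed disc. -/
lemma exists_norm_le_of_lattice (L : PeriodPair) :
    ∃ r, ∀ z : ℂ, ∃ w, ‖w‖ ≤ r ∧ z - w ∈ L.lattice := by
  obtain ⟨r, hr⟩ := (ZSpan.fundamentalDomain_isBounded L.basis).exists_norm_le
  refine ⟨r, fun z ↦ ⟨ZSpan.fract L.basis z, hr _ (ZSpan.fract_mem_fundamentalDomain _ z), ?_⟩⟩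
  rw [ZSpan.fract_apply, sub_sub_cancel, L.lattice_eq_span_range_basis]
  exact (ZSpan.floor L.basis z).2

/-- Modulo `Λ` an elliptic function has finitely many poles. -/
lemma IsElliptic.finite_polarCoeff_ne_zero (hf : IsElliptic L f)
    (hp : ∀ i j, p i - p j ∈ L.lattice → i = j) :
    {x : ι × ℕ | polarCoeff f (x.2 + 1) (p x.1) ≠ 0}.Finite := by
  obtain ⟨r, hr⟩ := exists_norm_le_of_lattice L
  choose w hwr hwL using hr
  have hcoeff : ∀ α j, polarCoeff f j (w α) = polarCoeff f j α := fun α j ↦ by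
    rw [← polarCoeff_add_period (hf.periodic _ (hwL α)) hf.meromorphic, add_sub_cancel]
  -- Poles are isolated, so a compact disc contains finitely many.
  have hfin : {α ∈ Metric.closedBall (0 : ℂ) r | ∃ j, polarCoeff f (j + 1) α ≠ 0}.Finite := by
    have hloc : ∀ α ∈ Metric.closedBall (0 : ℂ) r, ∃ t ∈ 𝓝[Metric.closedBall (0 : ℂ) r] α,
        ({α | ∃ j, polarCoeff f (j + 1) α ≠ 0} ∩ t).Finite := by
      intro α _
      have h1 := (hf.meromorphic α).eventually_analyticAt
      rw [eventually_nhdsWithin_iff] at h1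
      refine ⟨_, mem_nhdsWithin_of_mem_nhds h1, (Set.finite_singleton α).subset ?_⟩
      rintro z ⟨⟨j, hj⟩, hz⟩
      by_contra hne
      exact hj (by simp [(HasPrincipalPartAt.of_analyticAt (hz hne)).polarCoeff_eq])
    choose! t ht htfin using hloc
    obtain ⟨s, hs, hcover⟩ := (isCompact_closedBall (0 : ℂ) r).elim_nhdsWithin_subcover t ht
    refine (s.finite_toSet.biUnion fun α hα ↦ htfin α (hs α hα)).subset ?_
    rintro α ⟨hα, hj⟩
    obtain ⟨β, hβ, hαβ⟩ := Set.mem_iUnion₂.mp (hcover hα)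
    exact Set.mem_biUnion hβ ⟨hj, hαβ⟩
  have hfin' : {i | ∃ j, polarCoeff f (j + 1) (p i) ≠ 0}.Finite := by
    refine Set.Finite.of_finite_image (f := fun i ↦ w (p i)) (hfin.subset ?_) ?_
    · rintro _ ⟨i, ⟨j, hj⟩, rfl⟩
      exact ⟨by simpa using hwr (p i), j, by rwa [hcoeff]⟩
    · intro i _ j _ hij
      refine hp i j ?_
      have h := sub_mem (hwL (p i)) (hwL (p j))
      have hij' : w (p i) = w (p j) := hij
      rwa [hij', sub_sub_sub_cancel_right] at h
  choose P hP using fun α ↦ exists_hasPrincipalPartAt (hf.meromorphic α)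
  refine (hfin'.biUnion fun i _ ↦ ((Set.finite_le_nat (P (p i)).natDegree).image
    fun k ↦ (i, k))).subset ?_
  rintro ⟨i, k⟩ hik
  refine Set.mem_biUnion (show i ∈ {i | ∃ j, polarCoeff f (j + 1) (p i) ≠ 0} from ⟨k, hik⟩)
    ⟨k, ?_, rfl⟩
  rw [Set.mem_ofPred_eq, (hP (p i)).polarCoeff_eq] at hik
  exact (Nat.le_succ k).trans (Polynomial.le_natDegree_of_ne_zero hik)

/-- The coefficients `c_{k + 1}(f, p i)`, indexed by `(i, k)`, of an elliptic function `f` at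
points `p i` that are distinct modulo `Λ`. -/
noncomputable def IsElliptic.polarData (hf : IsElliptic L f)
    (hp : ∀ i j, p i - p j ∈ L.lattice → i = j) : ι × ℕ →₀ ℂ :=
  Finsupp.ofSupportFinite (fun x ↦ polarCoeff f (x.2 + 1) (p x.1))
    (hf.finite_polarCoeff_ne_zero hp)

lemma IsElliptic.polarData_apply (hf : IsElliptic L f)
    (hp : ∀ i j, p i - p j ∈ L.lattice → i = j) (x : ι × ℕ) :
    hf.polarData hp x = polarCoeff f (x.2 + 1) (p x.1) := rfl

/-! ### Linear combinations of translated derivatives of the zeta function -/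

/-- The combination of `ζ` and its derivatives, translated to the points `p i`, whose coefficient
of `(z - p i)^(-(k + 1))` is `b (i, k)` when the `p i` are distinct modulo `Λ`. -/
noncomputable def zetaSum (L : PeriodPair) (p : ι → ℂ) (b : ι × ℕ →₀ ℂ) (z : ℂ) : ℂ :=
  b.sum fun x c ↦ c * (-1) ^ x.2 / (x.2.factorial : ℂ)
    * iteratedDeriv x.2 (weierstrassZeta L) (z - p x.1)

/-- The sum of the residues of `zetaSum L p b`. -/
noncomputable def residueSum (b : ι × ℕ →₀ ℂ) : ℂ :=
  b.sum fun x c ↦ if x.2 = 0 then c else 0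

lemma zetaSum_sub (b b' : ι × ℕ →₀ ℂ) (z : ℂ) :
    zetaSum L p (b - b') z = zetaSum L p b z - zetaSum L p b' z :=
  Finsupp.sum_sub_index fun x c c' ↦ by ring

lemma residueSum_eq_finsum (b : ι × ℕ →₀ ℂ) : residueSum b = ∑ᶠ i, b (i, 0) := by
  classical
  have h1 : (Function.support fun i ↦ b (i, 0)) ⊆ (b.support.image Prod.fst : Finset ι) := by
    intro i hi
    exact Finset.mem_coe.mpr (Finset.mem_image.mpr ⟨(i, 0), Finsupp.mem_support_iff.mpr hi, rfl⟩)
  rw [finsum_eq_sum_of_support_subset _ h1, residueSum, Finsupp.sum, ← Finset.sum_filter]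
  have h2 : ∀ x ∈ {x ∈ b.support | x.2 = 0}, b x = b (x.1, 0) := by
    rintro ⟨i, k⟩ hx
    rw [(Finset.mem_filter.mp hx).2.symm]
  rw [Finset.sum_congr rfl h2,
    ← Finset.sum_image (s := {x ∈ b.support | x.2 = 0}) (g := Prod.fst) (f := fun i ↦ b (i, 0))]
  · refine Finset.sum_subset (Finset.image_subset_image (Finset.filter_subset _ _)) ?_
    intro i _ hi
    by_contra h
    exact hi (Finset.mem_image.mpr
      ⟨(i, 0), Finset.mem_filter.mpr ⟨Finsupp.mem_support_iff.mpr h, rfl⟩, rfl⟩)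
  · rintro ⟨i, k⟩ hx ⟨j, m⟩ hy (hij : i = j)
    have hx' : k = 0 := (Finset.mem_filter.mp hx).2
    have hy' : m = 0 := (Finset.mem_filter.mp hy).2
    rw [hij, hx', hy']

lemma zetaSum_add_lattice (b : ι × ℕ →₀ ℂ) {l : ℂ} (hl : l ∈ L.lattice) (z : ℂ) :
    zetaSum L p b (z + l) = zetaSum L p b z + weierstrassZeta L l * residueSum b := by
  simp only [zetaSum, residueSum, Finsupp.sum, Finset.mul_sum]
  rw [← Finset.sum_add_distrib]
  refine Finset.sum_congr rfl fun x _ ↦ ?_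
  rw [add_sub_right_comm, iteratedDeriv_weierstrassZeta_add_lattice L hl, mul_add]
  congr 1
  split_ifs with h
  · simp [h, mul_comm]
  · simp

lemma zetaSum_sub_period (b : ι × ℕ →₀ ℂ) {l : ℂ} (hl : l ∈ L.lattice) (z : ℂ) :
    zetaSum L p b (z - l) = zetaSum L p b z - weierstrassZeta L l * residueSum b := by
  have := zetaSum_add_lattice (p := p) b hl (z - l)
  rw [sub_add_cancel] at this
  rw [this, add_sub_cancel_right]

/-- Translating the argument by `s` permutes the summands, when the permutation `e` of the indices
translates the points by `-s`. -/
lemma zetaSum_add {s : ℂ} (e : ι ≃ ι) (he : ∀ i, p (e i) = p i - s) (b : ι × ℕ →₀ ℂ) (z : ℂ) :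
    zetaSum L p b (z + s) =
      zetaSum L p (b.equivMapDomain (e.prodCongr (Equiv.refl ℕ))) z := by
  rw [Finsupp.equivMapDomain_eq_mapDomain, zetaSum, zetaSum, Finsupp.sum_mapDomain_index
    (by simp) (by intros; ring)]
  refine Finsupp.sum_congr fun x _ ↦ ?_
  simp only [Equiv.prodCongr_apply, Prod.map_fst, Prod.map_snd, Equiv.refl_apply, he]
  congr 2
  ring

open Classical in
lemma hasPrincipalPartAt_zetaSum (hp : ∀ i j, p i - p j ∈ L.lattice → i = j) (b : ι × ℕ →₀ ℂ)
    (i : ι) :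
    HasPrincipalPartAt (zetaSum L p b) (p i)
      (b.sum fun x c ↦ if x.1 = i then c • Polynomial.X ^ (x.2 + 1) else 0) := by
  refine HasPrincipalPartAt.sum fun x _ ↦ ?_
  have hsub : ∀ z, z - p x.1 = z + -p x.1 := fun z ↦ sub_eq_add_neg _ _
  beta_reduce
  split_ifs with h
  · have h0 : p i + -p x.1 ∈ L.lattice := by rw [h, add_neg_cancel]; exact zero_mem _
    have h1 :=
      (hasPrincipalPartAt_iteratedDeriv_weierstrassZeta L h0 x.2).comp_add_const.const_mul
      (b x * (-1) ^ x.2 / (x.2.factorial : ℂ))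
    simp only [hsub]
    convert! h1 using 1
    rw [smul_smul]
    congr 1
    have hfac : (x.2.factorial : ℂ) ≠ 0 := Nat.cast_ne_zero.mpr (Nat.factorial_ne_zero _)
    have hsq : ((-1 : ℂ) ^ x.2) * (-1) ^ x.2 = 1 := by rw [← mul_pow]; simp
    field_simp
    linear_combination (-b x) * hsq
  · have h0 : p i + -p x.1 ∉ L.lattice := fun hmem ↦
      h (hp _ _ (by rwa [sub_eq_add_neg])).symm
    simp only [hsub]
    exact .of_analyticAt (analyticAt_const.fun_mul (AnalyticAt.fun_comp (f := fun z ↦ z + -p x.1)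
      (analyticAt_iteratedDeriv_weierstrassZeta L h0 x.2) (by fun_prop)))

lemma polarCoeff_zetaSum (hp : ∀ i j, p i - p j ∈ L.lattice → i = j) (b : ι × ℕ →₀ ℂ)
    (i : ι) (k : ℕ) : polarCoeff (zetaSum L p b) (k + 1) (p i) = b (i, k) := by
  classical
  rw [(hasPrincipalPartAt_zetaSum hp b i).polarCoeff_eq, Finsupp.sum, Polynomial.finsetSum_coeff]
  rw [Finset.sum_eq_single (i, k)]
  · simp
  · rintro ⟨j, m⟩ _ hne
    by_cases h : j = i
    · have hm : k ≠ m := by rintro rfl; exact hne (by rw [h])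
      simp [h, Polynomial.coeff_X_pow, hm]
    · simp [h]
  · intro h
    simp [Finsupp.notMem_support_iff.mp h]

lemma meromorphic_zetaSum (hp : IsTransversal L p) (b : ι × ℕ →₀ ℂ) :
    Meromorphic (zetaSum L p b) := by
  intro α
  obtain ⟨i, hi⟩ := hp.exists_sub_mem α
  have h := hasPrincipalPartAt_zetaSum hp.eq_of_sub_mem b i
  rw [← sub_sub_cancel α (p i), sub_eq_add_neg] at h
  have h1 := (h.comp_add_const.add (.of_analyticAt (analyticAt_const
    (v := weierstrassZeta L (α - p i) * residueSum b)))).congr (g := zetaSum L p b)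
    (.of_forall fun z ↦ ?_)
  · exact h1.meromorphicAt
  · beta_reduce
    rw [← sub_eq_add_neg, zetaSum_sub_period b hi, sub_add_cancel]

lemma isElliptic_zetaSum (hp : IsTransversal L p) {b : ι × ℕ →₀ ℂ} (hb : residueSum b = 0) :
    IsElliptic L (zetaSum L p b) where
  meromorphic := meromorphic_zetaSum hp b
  periodic l hl z := by rw [zetaSum_add_lattice b hl, hb, mul_zero, add_zero]

/-- The expansion of an elliptic function by its principal parts, together with the residue
theorem on the torus. The difference of `f` and the sum with the same principal parts is an
entire function with elliptic derivative, hence `a z + C`; comparing periods, `a l = - ζ(l) S` for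
`l ∈ Λ`, where `S` is the sum of the residues, which forces `S = 0` and `a = 0`. -/
theorem IsElliptic.exists_eq_const_add_zetaSum (hf : IsElliptic L f) (hp : IsTransversal L p) :
    residueSum (hf.polarData hp.eq_of_sub_mem) = 0 ∧
      ∃ C, f =ᶠ[codiscrete ℂ] fun z ↦ C + zetaSum L p (hf.polarData hp.eq_of_sub_mem) z := by
  set b := hf.polarData hp.eq_of_sub_mem with hb
  set F : ℂ → ℂ := fun z ↦ f z - zetaSum L p b z with hF
  have hFper : ∀ l ∈ L.lattice, ∀ z, F (z + l) = F z - weierstrassZeta L l * residueSum b := by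
    intro l hl z
    simp only [hF]
    rw [hf.periodic l hl, zetaSum_add_lattice b hl]
    ring
  have hF0 : ∀ i, HasPrincipalPartAt F (p i) 0 := by
    intro i
    obtain ⟨P, hP⟩ := exists_hasPrincipalPartAt (hf.meromorphic (p i))
    have hQ := hasPrincipalPartAt_zetaSum hp.eq_of_sub_mem b i
    have hPQ := hP.sub hQ
    convert! hPQ using 1
    ext (_ | k)
    · rw [hPQ.1, Polynomial.coeff_zero]
    · rw [Polynomial.coeff_sub, ← hP.polarCoeff_eq, ← hQ.polarCoeff_eq,
        polarCoeff_zetaSum hp.eq_of_sub_mem, hb, IsElliptic.polarData_apply, sub_self,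
        Polynomial.coeff_zero]
  have hFα : ∀ α, HasPrincipalPartAt F α 0 := by
    intro α
    obtain ⟨i, hi⟩ := hp.exists_sub_mem α
    have h := hF0 i
    rw [← sub_sub_cancel α (p i), sub_eq_add_neg] at h
    have h1 := (h.comp_add_const.add (.of_analyticAt (analyticAt_const
      (v := -(weierstrassZeta L (α - p i) * residueSum b)))))
    rw [add_zero] at h1
    refine h1.congr (.of_forall fun z ↦ ?_)
    have h2 := hFper _ hi (z + -(α - p i))
    rw [neg_add_cancel_right] at h2
    rw [h2]
    ring
  obtain ⟨H, hH, hHF⟩ := exists_differentiable_of_hasPrincipalPartAt_zero hFα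
  have hHper : ∀ l ∈ L.lattice, ∀ z, H (z + l) = H z - weierstrassZeta L l * residueSum b := by
    intro l hl
    refine congr_fun (eq_of_eventuallyEq_nhdsNE (f := fun z ↦ H (z + l))
      (hH.continuous.comp (by fun_prop)) (hH.continuous.sub continuous_const) fun α ↦ ?_)
    filter_upwards [hHF α, (tendsto_add_const_nhdsNE l α).eventually (hHF (α + l))] with z h1 h2
    rw [← h1, ← h2, hFper l hl]
  obtain ⟨a, ha⟩ := exists_eq_const_of_periodic L (H := deriv H)
    (hH.contDiff (n := 2)).differentiable_deriv_two (by
    intro l hl z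
    rw [← deriv_comp_add_const, funext (hHper l hl), deriv_sub_const])
  have hlin : ∀ z, H z = a * z + H 0 := by
    have hd : ∀ z, HasDerivAt (fun z ↦ H z - a * z) 0 z := fun z ↦ by
      have := (hH z).hasDerivAt.sub ((hasDerivAt_id z).const_mul a)
      rw [ha, mul_one, sub_self] at this
      exact this
    intro z
    have := is_const_of_deriv_eq_zero (fun z ↦ (hd z).differentiableAt) (fun z ↦ (hd z).deriv) z 0
    linear_combination this
  -- Compare the increments of `H` and of `a z + C` along a period.
  have hal : ∀ l ∈ L.lattice, a * l = -(weierstrassZeta L l * residueSum b) := by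
    intro l hl
    have h1 := hHper l hl 0
    rw [hlin (0 + l)] at h1
    linear_combination h1
  have hS : residueSum b = 0 := by
    by_contra hne
    refine not_periodic_weierstrassZeta_add_mul L (a / residueSum b) fun l hl z ↦ ?_
    rw [weierstrassZeta_add_lattice L hl]
    field_simp
    linear_combination hal l hl
  have ha0 : a = 0 := by
    have h1 := hal L.ω₁ L.ω₁_mem_lattice
    rw [hS, mul_zero, neg_zero] at h1
    exact (mul_eq_zero.mp h1).resolve_right (L.indep.ne_zero 0)
  refine ⟨hS, H 0, eventuallyEq_codiscrete_iff.mpr fun α ↦ ?_⟩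
  filter_upwards [hHF α] with z hz
  have h1 := hlin z
  rw [ha0, zero_mul, zero_add] at h1
  rw [← h1, ← hz, hF]
  ring

/-! ### Summation by parts over `ℤ` -/

/-- A finitely supported function on `ℤ` of sum zero is the difference of a finitely supported
function, namely of its partial sums. -/
lemma exists_finsupp_sub_eq (u : ℤ →₀ ℂ) (hu : ∑ᶠ n, u n = 0) :
    ∃ v : ℤ →₀ ℂ, (∀ n, v (n + 1) - v n = u n) ∧ (u = 0 → v = 0) := by
  classical
  set S := u.support with hS
  have hsum : ∑ m ∈ S, u m = 0 := by
    rw [← hu, finsum_eq_sum_of_support_subset _ (s := S) (by simp [hS])]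
  obtain ⟨a, ha⟩ := S.bddBelow
  obtain ⟨b, hb⟩ := S.bddAbove
  set v : ℤ → ℂ := fun n ↦ ∑ m ∈ S, if m < n then u m else 0 with hv
  have hfin : (Function.support v).Finite := by
    refine (Set.finite_Icc a b).subset fun n hn ↦ ?_
    by_contra hnab
    refine hn ?_
    rw [Set.mem_Icc, not_and_or, not_le, not_le] at hnab
    rcases hnab with h | h
    · exact Finset.sum_eq_zero fun m hm ↦ if_neg (not_lt.mpr (h.le.trans (ha hm)))
    · rw [← hsum]
      exact Finset.sum_congr rfl fun m hm ↦ if_pos ((hb hm).trans_lt h)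
  refine ⟨Finsupp.ofSupportFinite v hfin, fun n ↦ ?_, fun h ↦ ?_⟩
  · change v (n + 1) - v n = u n
    simp only [hv]
    rw [← Finset.sum_sub_distrib]
    have h1 : ∀ m ∈ S, ((if m < n + 1 then u m else 0) - if m < n then u m else 0) =
        if m = n then u n else 0 := by
      intro m _
      rcases lt_trichotomy m n with h | h | h
      · rw [if_pos (by omega), if_pos h, if_neg h.ne, sub_self]
      · subst h
        rw [if_pos (by omega), if_neg (lt_irrefl _), if_pos rfl, sub_zero]
      · rw [if_neg (by omega), if_neg (by omega), if_neg (by omega), sub_zero]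
    rw [Finset.sum_congr rfl h1, Finset.sum_ite_eq']
    split_ifs with h
    · rfl
    · exact (Finsupp.notMem_support_iff.mp h).symm
  · ext n
    change v n = 0
    simp [hv, hS, h]

variable {κ : Type*}

/-- The translation `n ↦ n - 1` of the second coordinate. -/
def predSnd (κ : Type*) : κ × ℤ ≃ κ × ℤ := (Equiv.refl κ).prodCongr (Equiv.subRight 1)

lemma finsum_comp_succ (c : κ × ℤ → ℂ) : ∑ᶠ x : κ × ℤ, c (x.1, x.2 + 1) = ∑ᶠ x, c x :=
  finsum_comp_equiv (predSnd κ).symm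

lemma hasFiniteSupport_comp_succ {c : κ × ℤ → ℂ} (hc : c.HasFiniteSupport) :
    (fun x : κ × ℤ ↦ c (x.1, x.2 + 1)).HasFiniteSupport :=
  Set.Finite.preimage ((predSnd κ).symm.injective.injOn) hc

/-- Summation by parts. -/
lemma finsum_snd_mul_sub (c : κ × ℤ → ℂ) (hc : c.HasFiniteSupport) :
    ∑ᶠ x : κ × ℤ, (x.2 : ℂ) * (c (x.1, x.2 + 1) - c x) = -∑ᶠ x, c x := by
  have hmul : (fun x : κ × ℤ ↦ (x.2 : ℂ) * c x).HasFiniteSupport :=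
    Set.Finite.subset hc fun x hx h ↦ hx (by simp [h])
  have h1 := finsum_comp_succ (fun x : κ × ℤ ↦ (x.2 : ℂ) * c x)
  have h2 := finsum_sub_distrib
    ((hasFiniteSupport_comp_succ hmul).fun_sub hmul) (hasFiniteSupport_comp_succ hc)
  rw [finsum_sub_distrib (hasFiniteSupport_comp_succ hmul) hmul, h1, sub_self, zero_sub,
    finsum_comp_succ] at h2
  rw [← h2]
  refine finsum_congr fun x ↦ ?_
  push_cast
  ring

/-- The family `(ω, n, k) ↦ b (ω, n + 1, k)`. -/
noncomputable def succCoeff (b : (κ × ℤ) × ℕ →₀ ℂ) : (κ × ℤ) × ℕ →₀ ℂ :=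
  b.equivMapDomain ((predSnd κ).prodCongr (Equiv.refl ℕ))

lemma hasFiniteSupport_coeff (b : (κ × ℤ) × ℕ →₀ ℂ) (k : ℕ) :
    (fun x ↦ b (x, k)).HasFiniteSupport :=
  Set.Finite.preimage (f := fun x ↦ (x, k)) (Prod.mk_left_injective k).injOn
    b.hasFiniteSupport

/-- A family is of the form `b (ω, n + 1, k) - b (ω, n, k)` once its sums over `n` vanish. -/
lemma exists_succCoeff_sub_eq (c : (κ × ℤ) × ℕ →₀ ℂ)
    (hc : ∀ ω k, ∑ᶠ n : ℤ, c ((ω, n), k) = 0) : ∃ b, succCoeff b - b = c := by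
  classical
  have hinj : ∀ y : κ × ℕ, Function.Injective fun n : ℤ ↦ ((y.1, n), y.2) := by
    intro y m n h
    simpa using h
  choose v hv hv0 using fun y : κ × ℕ ↦ exists_finsupp_sub_eq
    (c.comapDomain (fun n : ℤ ↦ ((y.1, n), y.2)) (hinj y).injOn) (hc y.1 y.2)
  have hfin : (Function.support fun x : (κ × ℤ) × ℕ ↦ v (x.1.1, x.2) x.1.2).Finite := by
    refine (((c.support.image fun x ↦ (x.1.1, x.2)).biUnion fun y ↦
      (v y).support.image fun n ↦ ((y.1, n), y.2)).finite_toSet).subset ?_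
    rintro ⟨⟨ω, n⟩, k⟩ hx
    have hx' : v (ω, k) n ≠ 0 := hx
    simp only [Finset.coe_biUnion, Set.mem_iUnion]
    refine ⟨(ω, k), ?_, ?_⟩
    · by_contra hmem
      refine hx' ?_
      rw [hv0 (ω, k), Finsupp.zero_apply]
      ext m
      rw [Finsupp.comapDomain_apply, Finsupp.zero_apply]
      by_contra hm
      exact hmem (Finset.mem_coe.mpr (Finset.mem_image.mpr
        ⟨((ω, m), k), Finsupp.mem_support_iff.mpr hm, rfl⟩))
    · exact Finset.mem_coe.mpr (Finset.mem_image.mpr ⟨n, Finsupp.mem_support_iff.mpr hx', rfl⟩)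
  refine ⟨Finsupp.ofSupportFinite _ hfin, ?_⟩
  ext ⟨⟨ω, n⟩, k⟩
  exact hv (ω, k) n

/-! ### The expansion relative to a pinning -/

namespace AnalyticPinning

variable {L : PeriodPair} {s : ℂ} (R : AnalyticPinning L s) {f : ℂ → ℂ}

/-- The points `q_ω + n s`. -/
noncomputable def point (x : Orbit L s × ℤ) : ℂ := R.rep x.1 + x.2 * s

lemma point_predSnd (x : Orbit L s × ℤ) : R.point (predSnd _ x) = R.point x - s := by
  simp only [point, predSnd, Equiv.prodCongr_apply, Prod.map_fst, Prod.map_snd, Equiv.refl_apply,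
    Equiv.subRight_apply]
  push_cast
  ring

lemma point_succ (ω : Orbit L s) (n : ℤ) : R.point (ω, n + 1) = R.point (ω, n) + s := by
  simp only [point]
  push_cast
  ring

/-- As no nonzero multiple of `s` is a period, the points `q_ω + n s` represent every class modulo
`Λ` exactly once. -/
lemma isTransversal_point (hs : s ∉ Submodule.span ℚ (L.lattice : Set ℂ)) :
    IsTransversal L R.point where
  eq_of_sub_mem := by
    rintro ⟨ω, n⟩ ⟨ω', m⟩ h
    have hle : L.lattice ≤ orbitLattice L s := le_sup_left
    have hsmem : ∀ n : ℤ, (n : ℂ) * s ∈ orbitLattice L s := fun n ↦ by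
      rw [← zsmul_eq_mul]
      exact Submodule.smul_mem _ _ (Submodule.mem_sup_right (Submodule.mem_span_singleton_self s))
    have hω : ω = ω' := by
      rw [← R.mk_rep ω, ← R.mk_rep ω', Submodule.Quotient.eq]
      have h1 := add_mem (hle h) (sub_mem (hsmem m) (hsmem n))
      convert! h1 using 1
      simp only [point]
      ring
    subst hω
    have h2 : ((n - m : ℤ) : ℂ) * s ∈ L.lattice := by
      convert! h using 1
      simp only [point]
      push_cast
      ring
    have h3 : n - m = 0 := by
      by_contra hne
      refine hs ?_
      have h4 := Submodule.smul_mem _ (((n - m : ℤ) : ℚ)⁻¹)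
        (Submodule.subset_span (R := ℚ) (s := (L.lattice : Set ℂ)) h2)
      convert! h4 using 1
      have hne' : ((n - m : ℤ) : ℂ) ≠ 0 := Int.cast_ne_zero.mpr hne
      rw [Rat.smul_def]
      push_cast at hne' ⊢
      field_simp
    rw [sub_eq_zero.mp h3]
  exists_sub_mem α := by
    have h1 : (Submodule.Quotient.mk α : Orbit L s) =
        Submodule.Quotient.mk (R.rep (Submodule.Quotient.mk α)) := (R.mk_rep _).symm
    obtain ⟨l, hl, y, hy, hly⟩ := Submodule.mem_sup.mp ((Submodule.Quotient.eq _).mp h1)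
    obtain ⟨n, rfl⟩ := Submodule.mem_span_singleton.mp hy
    refine ⟨(Submodule.Quotient.mk α, n), ?_⟩
    convert! hl using 1
    rw [zsmul_eq_mul] at hly
    simp only [point]
    linear_combination -hly

/-- The coefficients of `f` along the pinning: `(ω, n, k) ↦ c_{k + 1}(f, q_ω + n s)`. -/
noncomputable def coeffs (R : AnalyticPinning L s)
    (hs : s ∉ Submodule.span ℚ (L.lattice : Set ℂ)) (hf : IsElliptic L f) :
    (Orbit L s × ℤ) × ℕ →₀ ℂ :=
  hf.polarData (R.isTransversal_point hs).eq_of_sub_mem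

lemma hasZetaExpansion_iff (hs : s ∉ Submodule.span ℚ (L.lattice : Set ℂ))
    (hf : IsElliptic L f) (C : ℂ) :
    R.HasZetaExpansion f C ↔
      f =ᶠ[codiscrete ℂ] fun z ↦ C + zetaSum L R.point (R.coeffs hs hf) z := by
  have hsupp : {x : Orbit L s × ℤ × ℕ |
      polarCoeff f (x.2.2 + 1) (R.rep x.1 + x.2.1 * s) ≠ 0}.Finite :=
    Set.Finite.preimage (f := (Equiv.prodAssoc (Orbit L s) ℤ ℕ).symm)
      (Equiv.injective _).injOn (R.coeffs hs hf).hasFiniteSupport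
  have hsum : ∀ z, (∑ᶠ (ω : Orbit L s) (n : ℤ) (k : ℕ),
      polarCoeff f (k + 1) (R.rep ω + n * s) * (-1) ^ k / (k.factorial : ℂ)
        * iteratedDeriv k (weierstrassZeta L) (z - R.rep ω - n * s)) =
      zetaSum L R.point (R.coeffs hs hf) z := by
    intro z
    have h1 := finsum_curry₃ (fun x : Orbit L s × ℤ × ℕ ↦
      polarCoeff f (x.2.2 + 1) (R.rep x.1 + x.2.1 * s) * (-1) ^ x.2.2 / (x.2.2.factorial : ℂ)
        * iteratedDeriv x.2.2 (weierstrassZeta L) (z - R.rep x.1 - x.2.1 * s))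
      (Set.Finite.subset hsupp fun x hx h ↦ hx (by simp [h]))
    rw [← h1, ← finsum_comp_equiv (Equiv.prodAssoc (Orbit L s) ℤ ℕ), zetaSum, Finsupp.sum,
      finsum_eq_sum_of_support_subset _ (s := (R.coeffs hs hf).support)]
    · refine Finset.sum_congr rfl fun x _ ↦ ?_
      rw [point, ← sub_sub]
      rfl
    · intro x hx
      refine Finset.mem_coe.mpr (Finsupp.mem_support_iff.mpr fun h ↦ hx ?_)
      have h' : polarCoeff f (x.2 + 1) (R.rep x.1.1 + x.1.2 * s) = 0 := h
      simp [h']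
  simp only [HasZetaExpansion, hsum]
  exact ⟨fun h ↦ h.2, fun h ↦ ⟨hsupp, h⟩⟩

lemma existsUnique_hasZetaExpansion (hs : s ∉ Submodule.span ℚ (L.lattice : Set ℂ))
    (hf : IsElliptic L f) :
    ∃! C, R.HasZetaExpansion f C := by
  simp only [R.hasZetaExpansion_iff hs hf]
  obtain ⟨C, hC⟩ := (hf.exists_eq_const_add_zetaSum (R.isTransversal_point hs)).2
  refine ⟨C, hC, fun C' hC' ↦ ?_⟩
  obtain ⟨z, hz, hz'⟩ := ((eventuallyEq_codiscrete_iff.mp hC 0).and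
    (eventuallyEq_codiscrete_iff.mp hC' 0)).exists
  exact add_right_cancel (hz'.symm.trans hz)

lemma pano₀_eq_zero_iff (hs : s ∉ Submodule.span ℚ (L.lattice : Set ℂ))
    (hf : IsElliptic L f) :
    R.pano₀ f = 0 ↔ R.HasZetaExpansion f 0 := by
  have h := R.existsUnique_hasZetaExpansion hs hf
  rw [pano₀, dif_pos h.exists]
  exact ⟨fun h0 ↦ h0 ▸ h.exists.choose_spec, fun h0 ↦ h.unique h.exists.choose_spec h0⟩

lemma pano₁_eq_finsum (hs : s ∉ Submodule.span ℚ (L.lattice : Set ℂ))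
    (hf : IsElliptic L f) :
    R.pano₁ f = ∑ᶠ x : Orbit L s × ℤ, (x.2 : ℂ) * R.coeffs hs hf (x, 0) := by
  rw [finsum_curry]
  · rfl
  · exact Set.Finite.subset (hasFiniteSupport_coeff (R.coeffs hs hf) 0) fun x hx h ↦
      hx (by simp [show R.coeffs hs hf (x, 0) = 0 from h])

lemma orbitalResidue_eq_finsum (hs : s ∉ Submodule.span ℚ (L.lattice : Set ℂ))
    (hf : IsElliptic L f) (ω : Orbit L s) (k : ℕ) :
    orbitalResidue f ω (k + 1) = ∑ᶠ n : ℤ, R.coeffs hs hf ((ω, n), k) := by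
  conv_lhs => rw [← R.mk_rep ω]
  exact orbitalResidue_mk hf _ _

lemma zetaSum_point_add (b : (Orbit L s × ℤ) × ℕ →₀ ℂ) (z : ℂ) :
    zetaSum L R.point b (z + s) = zetaSum L R.point (succCoeff b) z :=
  zetaSum_add (predSnd _) R.point_predSnd b z

/-- Summation by parts turns the first moment of the residues of `f` into a sum of residues of a
solution `b` of the difference equation. -/
lemma pano₁_eq_neg_residueSum (hs : s ∉ Submodule.span ℚ (L.lattice : Set ℂ))
    (hf : IsElliptic L f) {b : (Orbit L s × ℤ) × ℕ →₀ ℂ}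
    (hb : succCoeff b - b = R.coeffs hs hf) : R.pano₁ f = -residueSum b := by
  rw [R.pano₁_eq_finsum hs hf, ← hb, residueSum_eq_finsum,
    ← finsum_snd_mul_sub _ (hasFiniteSupport_coeff b 0)]
  rfl

lemma orbitalResidue_eq_zero (hs : s ∉ Submodule.span ℚ (L.lattice : Set ℂ))
    (hf : IsElliptic L f) {b : (Orbit L s × ℤ) × ℕ →₀ ℂ}
    (hb : succCoeff b - b = R.coeffs hs hf) (ω : Orbit L s) (k : ℕ) :
    orbitalResidue f ω (k + 1) = 0 := by
  have hfin : (fun n : ℤ ↦ b ((ω, n), k)).HasFiniteSupport :=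
    Set.Finite.preimage (f := fun n : ℤ ↦ (ω, n)) (Prod.mk_right_injective ω).injOn
      (hasFiniteSupport_coeff b k)
  have hfin' : (fun n : ℤ ↦ b ((ω, n + 1), k)).HasFiniteSupport :=
    Set.Finite.preimage (f := fun n : ℤ ↦ n + 1) (add_left_injective 1).injOn hfin
  rw [R.orbitalResidue_eq_finsum hs hf, ← hb]
  refine (finsum_sub_distrib hfin' hfin).trans ?_
  rw [sub_eq_zero]
  exact finsum_comp_equiv (Equiv.addRight (1 : ℤ)) (f := fun n ↦ b ((ω, n), k))

end AnalyticPinning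

end EllipticSummability

open EllipticSummability in
theorem mainTheorem1 (L : PeriodPair) (s : ℂ)
    (hs : s ∉ Submodule.span ℚ (L.lattice : Set ℂ))
    (R : AnalyticPinning L s) (f : ℂ → ℂ) (hf : IsElliptic L f) :
    (∃! C : ℂ, R.HasZetaExpansion f C) ∧
    (IsSummable L s f ↔
      (∀ (ω : Orbit L s) (j : ℕ), 1 ≤ j → orbitalResidue f ω j = 0) ∧
        R.pano₀ f = 0 ∧ R.pano₁ f = 0) := by
  have hT := R.isTransversal_point hs
  refine ⟨R.existsUnique_hasZetaExpansion hs hf, ?_⟩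
  rw [R.pano₀_eq_zero_iff hs hf, R.hasZetaExpansion_iff hs hf, eventuallyEq_codiscrete_iff]
  constructor
  · rintro ⟨g, hg, hfg⟩
    rw [eventuallyEq_codiscrete_iff] at hfg
    obtain ⟨hres, C, hC⟩ := hg.exists_eq_const_add_zetaSum hT
    rw [eventuallyEq_codiscrete_iff] at hC
    have hb : succCoeff (R.coeffs hs hg) - R.coeffs hs hg = R.coeffs hs hf := by
      ext ⟨⟨ω, n⟩, k⟩
      have hτ := meromorphic_shift hg.meromorphic s (R.point (ω, n))
      have h1 := polarCoeff_congr (hfg (R.point (ω, n)))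
        (hτ.sub (hg.meromorphic (R.point (ω, n)))) (k + 1)
      rw [polarCoeff_sub hτ (hg.meromorphic _), polarCoeff_shift (hg.meromorphic _),
        ← R.point_succ] at h1
      exact h1.symm
    refine ⟨fun ω j hj ↦ ?_, fun α ↦ ?_, ?_⟩
    · obtain ⟨k, rfl⟩ := Nat.exists_eq_add_of_le' hj
      exact R.orbitalResidue_eq_zero hs hf hb ω k
    · filter_upwards [hfg α, hC α, (tendsto_add_const_nhdsNE s α).eventually (hC (α + s))]
        with z h1 h2 h3
      rw [h1, shift, h2, h3, ← hb, zetaSum_sub, ← R.zetaSum_point_add]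
      change _ = 0 + (zetaSum L R.point (hg.polarData hT.eq_of_sub_mem) (z + s) -
        zetaSum L R.point (hg.polarData hT.eq_of_sub_mem) z)
      ring
    · rw [R.pano₁_eq_neg_residueSum hs hf hb, neg_eq_zero]
      exact hres
  · rintro ⟨hores, hexp, hp1⟩
    obtain ⟨b, hb⟩ := exists_succCoeff_sub_eq (R.coeffs hs hf) fun ω k ↦ by
      rw [← R.orbitalResidue_eq_finsum hs hf, hores ω (k + 1) (Nat.le_add_left 1 k)]
    rw [R.pano₁_eq_neg_residueSum hs hf hb, neg_eq_zero] at hp1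
    refine ⟨zetaSum L R.point b, isElliptic_zetaSum hT hp1, eventuallyEq_codiscrete_iff.mpr
      fun α ↦ ?_⟩
    filter_upwards [hexp α] with z hz
    rw [hz, zero_add, shift, R.zetaSum_point_add, ← zetaSum_sub, hb]
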